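/- Consider a dual-hop amplify-and-forward relay system: single-antenna source and destination, and a relay with $N\ge 1$ antennas that splits its received signal with power splitting ratio $\theta\in(0,1)$, harvests energy with conversion efficiency $\eta>0$, and forwards with the harvested energy. Let $d_1,d_2>0$ be the source-relay and relay-destination distances, $\tau$ the path loss exponent, $P_s$ the source power, $N_0>0$ the noise power at each relay antenna and at the destination, and $\rho_1=P_s/N_0$. The channel vectors $\mathbf h_1\in\mathbb C^{N\times 1}$ and $\mathbf h_2\in\mathbb C^{1\times N}$ have i.i.d. $\mathcal{CN}(0,1)$ entries and are independent of each other. The relay receives the information signal $\mathbf y_r=\sqrt{(1-\theta)P_s/d_1^\tau}\,\mathbf h_1x+\mathbf n_r$, where $x$ has unit power and $\mathbf n_r$ has covariance $N_0\mathbf I$; it transmits $\mathbf W\mathbf y_r$ with $\mathbf W=\omega\,\mathbf h_2^\dagger\mathbf h_1^\dagger/(\|\mathbf h_2\|\|\mathbf h_1\|)$, where $\omega^2=P_r/\big((1-\theta)P_s\|\mathbf h_1\|^2/d_1^\tau+N_0\big)$ and $P_r=\eta\theta P_s\|\mathbf h_1\|^2/d_1^\tau$; and the destination receives $y_d=\sqrt{1/d_2^\tau}\,\mathbf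 h_2\mathbf W\mathbf y_r+n_d$, where $n_d$ has variance $N_0$. Almost surely, the resulting end-to-end signal-to-noise ratio is $$\gamma=\frac{\frac{\eta\theta(1-\theta)\rho_1^2}{d_1^{2\tau}d_2^\tau}\|\mathbf h_2\|^2\|\mathbf h_1\|^4}{\frac{\eta\theta\rho_1}{d_1^\tau d_2^\tau}\|\mathbf h_2\|^2\|\mathbf h_1\|^2+\frac{(1-\theta)\rho_1}{d_1^\tau}\|\mathbf h_1\|^2+1}.$$ For a threshold $\gamma_{th}>0$ let $P_{out}(\rho_1)=\mathrm{Prob}(\gamma<\gamma_{th})$ be the outage probability. Then, as $\rho_1\to\infty$ with all other parameters fixed, $$P_{out}(\rho_1)\sim\frac{\left(d_1^\tau\gamma_{th}/\rho_1\right)^N}{\Gamma(N+1)}\left(\frac1{(1-\theta)^N}+\frac{\ln((1-\theta)\rho_1)-\ln(d_1^\tau\gamma_{th})-\mathbf C}{\Gamma(N)}\left(\frac{d_2^\tau}{\eta\theta}\right)^N\right),$$ where $\mathbf C$ is the Euler-Mascheroni constant and $f\sim g$ means $f/g\to1$. Hence the diversity order is $N$, i.e. $-\ln P_{out}(\rho_1)/\ln\rho_1\to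 N$, and $P_{out}$ decays as $\rho_1^{-N}\ln\rho_1$; precisely, $$P_{out}(\rho_1)\sim\frac{1}{\Gamma(N+1)\Gamma(N)}\left(\frac{d_1^\tau d_2^\tau\gamma_{th}}{\eta\theta}\right)^N\rho_1^{-N}\ln\rho_1 .$$ -/

import Mathlib

open MeasureTheory ProbabilityTheory Filter Topology Asymptotics
open scoped NNReal

noncomputable section

/-- The circularly symmetric complex Gaussian law `CN(0,1)`: independent real and imaginary
parts, each `N(0, 1/2)`, so that the mean is zero and `E |z|^2 = 1`. -/
def stdComplexNormal : Measure ℂ :=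
  ((gaussianReal 0 (1 / 2 : ℝ≥0)).prod (gaussianReal 0 (1 / 2 : ℝ≥0))).map
    (fun p : ℝ × ℝ => (⟨p.1, p.2⟩ : ℂ))

/-- Random channel vectors of the two hops: the `N + N` entries of `h₁` and `h₂` are
independent, and each of them has law `CN(0,1)`. -/
structure IsRayleighChannelPair {Ω : Type*} [MeasurableSpace Ω] (P : Measure Ω) {N : ℕ}
    (h₁ h₂ : Ω → EuclideanSpace ℂ (Fin N)) : Prop where
  law_left : ∀ i, HasLaw (fun w => h₁ w i) stdComplexNormal P
  law_right : ∀ i, HasLaw (fun w => h₂ w i) stdComplexNormal P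
  indep : iIndepFun
    (fun (k : Fin N ⊕ Fin N) (w : Ω) => Sum.elim (fun i => h₁ w i) (fun i => h₂ w i) k) P

/-- Deterministic parameters of the dual-hop power-splitting energy harvesting relay system. -/
structure RelaySystem where
  /-- power splitting ratio -/
  θ : ℝ
  /-- RF-to-DC conversion efficiency -/
  η : ℝ
  /-- source-relay distance -/
  d₁ : ℝ
  /-- relay-destination distance -/
  d₂ : ℝ
  /-- path loss exponent -/
  τ : ℝ
  /-- block time -/
  T : ℝ
  /-- noise power (at each relay antenna and at the destination) -/
  N₀ : ℝ

namespace RelaySystem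

variable (S : RelaySystem) {N : ℕ}

/-- Energy harvested by the relay during the first half of the block, for source power `Ps`. -/
def harvestedEnergy (Ps : ℝ) (h₁ : EuclideanSpace ℂ (Fin N)) : ℝ :=
  S.η * S.θ * Ps / S.d₁ ^ S.τ * ‖h₁‖ ^ 2 * (S.T / 2)

/-- Transmit power of the relay, which spends the harvested energy during half a block. -/
def relayPower (Ps : ℝ) (h₁ : EuclideanSpace ℂ (Fin N)) : ℝ :=
  S.harvestedEnergy Ps h₁ / (S.T / 2)

/-- The power constraint factor `ω`. -/
def powerFactor (Ps : ℝ) (h₁ : EuclideanSpace ℂ (Fin N)) : ℝ :=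
  Real.sqrt (S.relayPower Ps h₁ / ((1 - S.θ) * Ps / S.d₁ ^ S.τ * ‖h₁‖ ^ 2 + S.N₀))

/-- The relay matrix `W = ω h₂† h₁† / (‖h₂‖ ‖h₁‖)`: maximum ratio combining followed by maximum
ratio transmission. -/
def relayMatrix (Ps : ℝ) (h₁ h₂ : EuclideanSpace ℂ (Fin N)) : Matrix (Fin N) (Fin N) ℂ :=
  ((S.powerFactor Ps h₁ / (‖h₂‖ * ‖h₁‖) : ℝ) : ℂ) •
    Matrix.vecMulVec (fun i => star (h₂ i)) (fun j => star (h₁ j))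

/-- Power at the destination of the source component
`√(1/d₂^τ) h₂ W √((1-θ) Ps/d₁^τ) h₁ x` of the received signal, where `x` has unit power. -/
def signalPower (Ps : ℝ) (h₁ h₂ : EuclideanSpace ℂ (Fin N)) : ℝ :=
  (1 - S.θ) * Ps / (S.d₁ ^ S.τ * S.d₂ ^ S.τ) *
    ‖(fun i => h₂ i) ⬝ᵥ (S.relayMatrix Ps h₁ h₂).mulVec (fun i => h₁ i)‖ ^ 2

/-- Power at the destination of the noise component `√(1/d₂^τ) h₂ W n_r + n_d` of the received
signal, where `n_r` has covariance `N₀ I` and `n_d` is independent of it with variance `N₀`. -/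
def noisePower (Ps : ℝ) (h₁ h₂ : EuclideanSpace ℂ (Fin N)) : ℝ :=
  S.N₀ / S.d₂ ^ S.τ *
    ∑ j, ‖Matrix.vecMul (fun i => h₂ i) (S.relayMatrix Ps h₁ h₂) j‖ ^ 2 + S.N₀

/-- End-to-end signal-to-noise ratio for given channel vectors. -/
def snr (Ps : ℝ) (h₁ h₂ : EuclideanSpace ℂ (Fin N)) : ℝ :=
  S.signalPower Ps h₁ h₂ / S.noisePower Ps h₁ h₂

/-- Outage probability `Prob(γ < γth)`, as a function of `ρ₁ = Ps / N₀`
(the source power is `Ps = ρ₁ N₀`). -/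
def outageProb {Ω : Type*} [MeasurableSpace Ω] (P : Measure Ω)
    (h₁ h₂ : Ω → EuclideanSpace ℂ (Fin N)) (γth ρ₁ : ℝ) : ℝ :=
  P.real {w | S.snr (ρ₁ * S.N₀) (h₁ w) (h₂ w) < γth}

end RelaySystem

/-- `p` has diversity order `D`: `- ln p(ρ) / ln ρ → D` as `ρ → ∞`. -/
def HasDiversityOrder (p : ℝ → ℝ) (D : ℝ) : Prop :=
  Tendsto (fun ρ => -Real.log (p ρ) / Real.log ρ) atTop (𝓝 D)

end

/-!
Let `X = ‖h₁‖²` and `Y = ‖h₂‖²`. The signal-to-noise ratio of the relay link is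
`u v / (u + v + 1)`, where `u = p X` and `v = q X Y` with `p = (1 - θ) ρ / d₁^τ` and
`q = η θ ρ / (d₁^τ d₂^τ)` are the signal-to-noise ratios of the two hops (`RelaySystem.snr_eq`).
The harvested energy makes the second hop depend on the *product* of the two channel gains.

This gives a sandwich: outage at the threshold `g` occurs whenever `v < g`, and for every `M > g`
it forces `u < M` or `v < g (M + 1) / (M - g)` (`gammaProdCDF_le_outageProb`, `outageProb_le`).
The variables `X` and `Y` are independent with Gamma law of shape `N`
(`IsRayleighChannelPair.hasLaw_norm_sq`), so `u < M` has probability `O(ρ ^ (-N))`, while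
conditioning on `X` gives
`Prob(X Y < s) ∼ s ^ N log (1 / s) / (N! (N - 1)!)` as `s → 0` (`tendsto_gammaProdCDF_div`).
The logarithm dominates; letting `ρ → ∞` and then `M → ∞` yields
`P_out ∼ (d₁^τ d₂^τ g / (η θ)) ^ N log ρ / (ρ ^ N N! (N - 1)!)` (`tendsto_outageProb_div`).
All three assertions follow from this limit: the finer expression differs from the leading term
only by terms of order `ρ ^ (-N)`, which do not affect asymptotic equivalence.

Shapes are written `n + 1` throughout, since the number of antennas is positive.
-/

/-! ### Gamma laws of integer shape -/

lemma gammaPDF_natCast_add_one (n : ℕ) {x : ℝ} (hx : 0 ≤ x) :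
    gammaPDF ((n + 1 : ℕ) : ℝ) 1 x = ENNReal.ofReal (x ^ n / n.factorial * Real.exp (-x)) := by
  rw [gammaPDF_of_nonneg hx]
  congr 1
  push_cast
  rw [Real.Gamma_nat_eq_factorial, add_sub_cancel_right, Real.rpow_natCast, Real.one_rpow]
  ring_nf

lemma measurable_gammaPDF (a r : ℝ) : Measurable (gammaPDF a r) :=
  (measurable_gammaPDFReal a r).ennreal_ofReal

instance isProbabilityMeasure_gammaMeasure_succ (n : ℕ) :
    IsProbabilityMeasure (gammaMeasure ((n + 1 : ℕ) : ℝ) 1) :=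
  isProbabilityMeasure_gammaMeasure (by positivity) one_pos

/-- Adding an independent exponential variable raises the shape of a Gamma law by one. -/
lemma gammaMeasure_conv_gammaMeasure_one (n : ℕ) :
    gammaMeasure ((n + 1 : ℕ) : ℝ) 1 ∗ gammaMeasure ((0 + 1 : ℕ) : ℝ) 1
      = gammaMeasure ((n + 1 + 1 : ℕ) : ℝ) 1 := by
  unfold gammaMeasure
  rw [conv_withDensity_eq_lconvolution (measurable_gammaPDF _ _) (measurable_gammaPDF _ _)]
  congr 1
  ext x
  rw [lconvolution_def]
  rcases lt_or_ge x 0 with hx | hx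
  · rw [gammaPDF_of_neg hx]
    refine (lintegral_congr fun y => ?_).trans lintegral_zero
    rcases lt_or_ge y 0 with hy | hy
    · rw [gammaPDF_of_neg hy, zero_mul]
    · rw [gammaPDF_of_neg (show -y + x < 0 by linarith), mul_zero]
  · rw [gammaPDF_natCast_add_one _ hx]
    have h1 : ∀ y, gammaPDF ((n + 1 : ℕ) : ℝ) 1 y * gammaPDF ((0 + 1 : ℕ) : ℝ) 1 (-y + x)
        = (Set.Icc 0 x).indicator
          (fun y => ENNReal.ofReal (Real.exp (-x) / n.factorial * y ^ n)) y := by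
      intro y
      by_cases hy : y ∈ Set.Icc 0 x
      · rw [Set.indicator_of_mem hy, gammaPDF_natCast_add_one _ hy.1,
          gammaPDF_natCast_add_one _ (by linarith [hy.2] : 0 ≤ -y + x),
          ← ENNReal.ofReal_mul (by have := hy.1; positivity)]
        congr 1
        have : Real.exp (-x) = Real.exp (-y) * Real.exp (-(-y + x)) := by
          rw [← Real.exp_add]; congr 1; ring
        rw [this]
        simp
        ring
      · rw [Set.indicator_of_notMem hy]
        rcases lt_or_ge y 0 with h0 | h0
        · rw [gammaPDF_of_neg h0, zero_mul]
        · have : x < y := by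
            by_contra h
            exact hy ⟨h0, not_lt.1 h⟩
          rw [gammaPDF_of_neg (show -y + x < 0 by linarith), mul_zero]
    simp_rw [h1]
    rw [lintegral_indicator measurableSet_Icc, ← ofReal_integral_eq_lintegral_ofReal]
    · rw [integral_Icc_eq_integral_Ioc, ← intervalIntegral.integral_of_le hx,
        intervalIntegral.integral_const_mul, integral_pow]
      congr 1
      rw [Nat.factorial_succ]
      push_cast
      field_simp
      simp
    · exact (Continuous.continuousOn (by fun_prop)).integrableOn_Icc
    · filter_upwards [ae_restrict_mem measurableSet_Icc] with y hy
      have := hy.1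
      positivity

lemma lintegral_gammaMeasure (n : ℕ) (f : ℝ → ENNReal) :
    ∫⁻ x, f x ∂gammaMeasure ((n + 1 : ℕ) : ℝ) 1
      = ∫⁻ x in Set.Ioi 0, ENNReal.ofReal (x ^ n / n.factorial * Real.exp (-x)) * f x := by
  rw [gammaMeasure, lintegral_withDensity_eq_lintegral_mul_non_measurable _
    (measurable_gammaPDF _ _) (ae_of_all _ fun x => by simp [gammaPDF]),
    ← lintegral_add_compl _ (measurableSet_Ici (a := (0 : ℝ))), Set.compl_Ici,
    setLIntegral_congr_fun (g := fun _ => 0) measurableSet_Iio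
      (fun x (hx : x < 0) => by simp [gammaPDF_of_neg hx]),
    lintegral_zero, add_zero, setLIntegral_congr Ioi_ae_eq_Ici.symm]
  refine setLIntegral_congr_fun measurableSet_Ioi fun x (hx : 0 < x) => ?_
  simp only [Pi.mul_apply]
  rw [gammaPDF_natCast_add_one _ hx.le]

/-! ### The squared norm of a complex Gaussian vector -/

/-- Squared modulus of a `CN(0,1)` variable: integration in polar coordinates shows that it is
exponential with mean one. -/
lemma map_norm_sq_stdComplexNormal :
    stdComplexNormal.map (fun z => ‖z‖ ^ 2) = gammaMeasure ((0 + 1 : ℕ) : ℝ) 1 := by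
  have hv : (1 / 2 : ℝ≥0) ≠ 0 := by norm_num
  have hmk : Measurable (fun p : ℝ × ℝ => (⟨p.1, p.2⟩ : ℂ)) :=
    Complex.measurableEquivRealProd.symm.measurable
  have hpdf : ∀ p : ℝ × ℝ, gaussianPDF 0 (1 / 2 : ℝ≥0) p.1 * gaussianPDF 0 (1 / 2 : ℝ≥0) p.2
      = ENNReal.ofReal (Real.pi⁻¹ * Real.exp (-(p.1 ^ 2 + p.2 ^ 2))) := by
    intro p
    rw [gaussianPDF, gaussianPDF, ← ENNReal.ofReal_mul (gaussianPDFReal_nonneg _ _ _)]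
    congr 1
    simp only [gaussianPDFReal]
    have h2 : (2 * Real.pi * ((1 / 2 : ℝ≥0) : ℝ)) = Real.pi := by push_cast; ring
    rw [h2, mul_mul_mul_comm, ← Real.exp_add, ← mul_inv, Real.mul_self_sqrt Real.pi_pos.le]
    congr 2
    push_cast
    ring
  refine Measure.ext_of_lintegral _ fun f hf => ?_
  rw [lintegral_map hf (by fun_prop), stdComplexNormal, lintegral_map (by fun_prop) hmk,
    gaussianReal_of_var_ne_zero _ hv,
    prod_withDensity (measurable_gaussianPDF _ _) (measurable_gaussianPDF _ _),
    lintegral_withDensity_eq_lintegral_mul_non_measurable _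
      (by have := measurable_gaussianPDF 0 (1 / 2 : ℝ≥0); fun_prop)
      (ae_of_all _ fun p => by rw [hpdf]; simp),
    ← Measure.volume_eq_prod, ← lintegral_comp_polarCoord_symm]
  have hpol : ∀ p ∈ polarCoord.target, ENNReal.ofReal p.1 •
      ((fun z : ℝ × ℝ => gaussianPDF 0 (1 / 2 : ℝ≥0) z.1 * gaussianPDF 0 (1 / 2 : ℝ≥0) z.2) *
        fun a : ℝ × ℝ => f (‖(⟨a.1, a.2⟩ : ℂ)‖ ^ 2)) (polarCoord.symm p)
      = ENNReal.ofReal (Real.pi⁻¹ * (p.1 * Real.exp (-p.1 ^ 2))) * f (p.1 ^ 2) := by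
    rintro ⟨r, t⟩ hp
    have hr : 0 < r := hp.1
    have hsq : (r * Real.cos t) ^ 2 + (r * Real.sin t) ^ 2 = r ^ 2 := by
      linear_combination r ^ 2 * Real.cos_sq_add_sin_sq t
    simp only [Pi.mul_apply, hpdf, polarCoord_symm_apply, smul_eq_mul]
    rw [hsq, Complex.sq_norm, Complex.normSq_mk, ← sq, ← sq, hsq, ← mul_assoc,
      ← ENNReal.ofReal_mul hr.le]
    congr 2
    ring
  rw [setLIntegral_congr_fun polarCoord.open_target.measurableSet hpol, polarCoord_target,
    Measure.volume_eq_prod, setLIntegral_prod _ (by fun_prop)]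
  simp only [lintegral_const, Measure.restrict_apply_univ, Real.volume_Ioo]
  have himg : (fun r : ℝ => r ^ 2) '' Set.Ioi 0 = Set.Ioi 0 := by
    ext y
    constructor
    · rintro ⟨r, hr, rfl⟩
      exact pow_pos (Set.mem_Ioi.1 hr) 2
    · intro hy
      exact ⟨√y, Real.sqrt_pos.2 hy, Real.sq_sqrt (le_of_lt hy)⟩
  rw [lintegral_gammaMeasure]
  conv_rhs => rw [← himg]
  rw [lintegral_image_eq_lintegral_abs_deriv_mul
    (f' := fun r => 2 * r) measurableSet_Ioi
    (fun x _ => by simpa using (hasDerivAt_pow 2 x).hasDerivWithinAt)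
    (fun x hx y hy h => (pow_left_inj₀ (le_of_lt hx) (le_of_lt hy) two_ne_zero).1 h)]
  refine setLIntegral_congr_fun measurableSet_Ioi fun r (hr : 0 < r) => ?_
  rw [mul_right_comm, ← ENNReal.ofReal_mul (by positivity), ← mul_assoc (ENNReal.ofReal |2 * r|),
    ← ENNReal.ofReal_mul (by positivity)]
  congr 2
  rw [abs_of_pos (by positivity)]
  simp
  field_simp
  ring

section Channel

variable {Ω : Type*} [MeasurableSpace Ω] {P : Measure Ω}

/-- A sum of `n + 1` independent exponential variables of mean one has Gamma law of shape
`n + 1`. -/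
lemma hasLaw_sum_gammaMeasure {ι : Type*} {X : ι → Ω → ℝ} (hind : iIndepFun X P)
    (hX : ∀ i, HasLaw (X i) (gammaMeasure ((0 + 1 : ℕ) : ℝ) 1) P) (n : ℕ) :
    ∀ s : Finset ι, s.card = n + 1 →
      HasLaw (∑ i ∈ s, X i) (gammaMeasure ((n + 1 : ℕ) : ℝ) 1) P := by
  classical
  induction n with
  | zero =>
    intro s hs
    obtain ⟨i, rfl⟩ := Finset.card_eq_one.1 hs
    simpa using hX i
  | succ n ih =>
    intro s hs
    obtain ⟨i, t, hi, rfl, ht⟩ := Finset.card_eq_succ.1 hs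
    rw [Finset.sum_insert hi, add_comm, ← gammaMeasure_conv_gammaMeasure_one]
    exact (hind.indepFun_finsetSum_of_notMem₀ (fun j => (hX j).aemeasurable) hi).hasLaw_add
      (ih t ht) (hX i)

/-- The squared norms of the two channel vectors are independent Gamma variables whose shape is
the number of antennas. -/
theorem IsRayleighChannelPair.hasLaw_norm_sq {n : ℕ}
    {h₁ h₂ : Ω → EuclideanSpace ℂ (Fin (n + 1))} [IsProbabilityMeasure P]
    (hch : IsRayleighChannelPair P h₁ h₂) :
    HasLaw (fun w => (‖h₁ w‖ ^ 2, ‖h₂ w‖ ^ 2))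
      ((gammaMeasure ((n + 1 : ℕ) : ℝ) 1).prod (gammaMeasure ((n + 1 : ℕ) : ℝ) 1)) P := by
  classical
  set H : Fin (n + 1) ⊕ Fin (n + 1) → Ω → ℂ :=
    fun k w => Sum.elim (fun i => h₁ w i) (fun i => h₂ w i) k with hH
  have hlawH : ∀ k, HasLaw (H k) stdComplexNormal P := by
    rintro (i | i)
    · exact hch.law_left i
    · exact hch.law_right i
  have hsq : HasLaw (fun z : ℂ => ‖z‖ ^ 2) (gammaMeasure ((0 + 1 : ℕ) : ℝ) 1) stdComplexNormal :=
    ⟨by fun_prop, map_norm_sq_stdComplexNormal⟩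
  set X : Fin (n + 1) ⊕ Fin (n + 1) → Ω → ℝ := fun k w => ‖H k w‖ ^ 2 with hXdef
  have hX : ∀ k, HasLaw (X k) (gammaMeasure ((0 + 1 : ℕ) : ℝ) 1) P := fun k => hsq.comp (hlawH k)
  have hind : iIndepFun X P :=
    hch.indep.comp (fun _ z => ‖z‖ ^ 2) (fun _ => by fun_prop)
  have hdisj : Disjoint (Finset.univ.map (Function.Embedding.inl (α := Fin (n + 1))
      (β := Fin (n + 1)))) (Finset.univ.map Function.Embedding.inr) := by
    simp [Finset.disjoint_left]
  have hpair := (hind.indepFun_finset₀ _ _ hdisj (fun k => (hX k).aemeasurable)).comp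
    (φ := fun x => ∑ k, x k) (ψ := fun x => ∑ k, x k) (by fun_prop) (by fun_prop)
  have e₁ : (fun w => ‖h₁ w‖ ^ 2) = ∑ k ∈ Finset.univ.map Function.Embedding.inl, X k := by
    ext w
    simp [EuclideanSpace.norm_sq_eq, hXdef, hH]
  have e₂ : (fun w => ‖h₂ w‖ ^ 2) = ∑ k ∈ Finset.univ.map Function.Embedding.inr, X k := by
    ext w
    simp [EuclideanSpace.norm_sq_eq, hXdef, hH]
  have hI : IndepFun (fun w => ‖h₁ w‖ ^ 2) (fun w => ‖h₂ w‖ ^ 2) P := by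
    rw [e₁, e₂]
    convert hpair using 1
    all_goals
      ext w
      simp only [Function.comp_apply, Finset.sum_apply]
      exact (Finset.sum_coe_sort _ (fun k => X k w)).symm
  refine IndepFun.hasLaw_prod ?_ ?_ hI
  · rw [e₁]
    exact hasLaw_sum_gammaMeasure hind hX n _ (by simp)
  · rw [e₂]
    exact hasLaw_sum_gammaMeasure hind hX n _ (by simp)

end Channel

/-! ### The product of two independent Gamma variables near zero -/

lemma setLIntegral_Ioo_pow_div_factorial (n : ℕ) {y c : ℝ} (hy : 0 ≤ y) (hc : 0 ≤ c) :
    ∫⁻ x in Set.Ioo 0 y, ENNReal.ofReal (c * (x ^ n / n.factorial))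
      = ENNReal.ofReal (c * (y ^ (n + 1) / (n + 1).factorial)) := by
  rw [← ofReal_integral_eq_lintegral_ofReal]
  · rw [← integral_Ioc_eq_integral_Ioo, ← intervalIntegral.integral_of_le hy,
      intervalIntegral.integral_const_mul, intervalIntegral.integral_div, integral_pow,
      Nat.factorial_succ]
    congr 1
    push_cast
    field_simp
    simp
  · exact ((Continuous.continuousOn (by fun_prop)).integrableOn_Icc).mono_set
      Set.Ioo_subset_Icc_self
  · filter_upwards [ae_restrict_mem measurableSet_Ioo] with x hx
    have := hx.1
    positivity

lemma setLIntegral_Ioc_const_mul_inv {a b c : ℝ} (ha : 0 < a) (hab : a ≤ b) (hc : 0 ≤ c) :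
    ∫⁻ x in Set.Ioc a b, ENNReal.ofReal (c * x⁻¹) = ENNReal.ofReal (c * Real.log (b / a)) := by
  rw [← ofReal_integral_eq_lintegral_ofReal]
  · rw [← intervalIntegral.integral_of_le hab, intervalIntegral.integral_const_mul,
      integral_inv_of_pos ha (ha.trans_le hab)]
  · refine (ContinuousOn.integrableOn_Icc ?_).mono_set Set.Ioc_subset_Icc_self
    exact continuousOn_const.mul (continuousOn_id.inv₀ fun x hx => (ha.trans_le hx.1).ne')
  · filter_upwards [ae_restrict_mem measurableSet_Ioc] with x hx
    have := ha.trans hx.1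
    positivity

lemma gammaMeasure_Iio (n : ℕ) (y : ℝ) :
    gammaMeasure ((n + 1 : ℕ) : ℝ) 1 (Set.Iio y)
      = ∫⁻ x in Set.Ioo 0 y, ENNReal.ofReal (x ^ n / n.factorial * Real.exp (-x)) := by
  rw [← lintegral_indicator_one measurableSet_Iio, lintegral_gammaMeasure,
    ← Set.Ioi_inter_Iio, Set.inter_comm, ← setLIntegral_indicator measurableSet_Iio]
  refine lintegral_congr fun x => ?_
  by_cases hx : x ∈ Set.Iio y <;> simp [hx]

lemma gammaMeasure_Iio_le (n : ℕ) {y : ℝ} (hy : 0 ≤ y) :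
    gammaMeasure ((n + 1 : ℕ) : ℝ) 1 (Set.Iio y)
      ≤ ENNReal.ofReal (y ^ (n + 1) / (n + 1).factorial) := by
  rw [gammaMeasure_Iio, ← one_mul (y ^ (n + 1) / _),
    ← setLIntegral_Ioo_pow_div_factorial n hy zero_le_one]
  refine setLIntegral_mono' measurableSet_Ioo fun x hx => ENNReal.ofReal_le_ofReal ?_
  rw [one_mul]
  have := hx.1
  exact mul_le_of_le_one_right (by positivity) (Real.exp_le_one_iff.2 (by linarith))

lemma le_gammaMeasure_Iio (n : ℕ) {y : ℝ} (hy : 0 ≤ y) :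
    ENNReal.ofReal (Real.exp (-y) * (y ^ (n + 1) / (n + 1).factorial))
      ≤ gammaMeasure ((n + 1 : ℕ) : ℝ) 1 (Set.Iio y) := by
  rw [gammaMeasure_Iio, ← setLIntegral_Ioo_pow_div_factorial n hy (Real.exp_nonneg _)]
  refine setLIntegral_mono' measurableSet_Ioo fun x hx => ENNReal.ofReal_le_ofReal ?_
  have := hx.1
  rw [mul_comm]
  gcongr
  exact hx.2.le

/-- Distribution function of the product of two independent Gamma variables of shape `n + 1`
and rate one. -/
noncomputable def gammaProdCDF (n : ℕ) (s : ℝ) : ℝ :=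
  ((gammaMeasure ((n + 1 : ℕ) : ℝ) 1).prod (gammaMeasure ((n + 1 : ℕ) : ℝ) 1)).real
    {p : ℝ × ℝ | p.1 * p.2 < s}

lemma measurableSet_mul_lt (s : ℝ) : MeasurableSet {p : ℝ × ℝ | p.1 * p.2 < s} :=
  measurableSet_lt (by fun_prop) measurable_const

/-- Conditioning on the first factor. -/
lemma ofReal_gammaProdCDF (n : ℕ) (s : ℝ) :
    ENNReal.ofReal (gammaProdCDF n s) = ∫⁻ x in Set.Ioi 0,
      ENNReal.ofReal (x ^ n / n.factorial * Real.exp (-x)) *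
        gammaMeasure ((n + 1 : ℕ) : ℝ) 1 (Set.Iio (s / x)) := by
  rw [gammaProdCDF, ofReal_measureReal, Measure.prod_apply (measurableSet_mul_lt s),
    lintegral_gammaMeasure]
  refine setLIntegral_congr_fun measurableSet_Ioi fun x (hx : 0 < x) => ?_
  congr 2
  ext y
  simp [lt_div_iff₀' hx]

lemma gammaProdCDF_le (n : ℕ) {s : ℝ} (hs : 0 < s) (hs1 : s ≤ 1) :
    gammaProdCDF n s ≤ s ^ (n + 1) / (n + 1).factorial +
      s ^ (n + 1) / ((n + 1).factorial * n.factorial) * (Real.log s⁻¹ + 1) := by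
  have hC : 0 ≤ s ^ (n + 1) / ((n + 1).factorial * n.factorial : ℝ) := by positivity
  have hlog : 0 ≤ Real.log s⁻¹ := Real.log_nonneg ((one_le_inv₀ hs).2 hs1)
  rw [← ENNReal.ofReal_le_ofReal_iff (by positivity), ofReal_gammaProdCDF,
    ← Set.Ioc_union_Ioi_eq_Ioi hs.le, lintegral_union measurableSet_Ioi
      (Set.Ioc_disjoint_Ioi le_rfl), ← Set.Ioc_union_Ioi_eq_Ioi hs1,
    lintegral_union measurableSet_Ioi (Set.Ioc_disjoint_Ioi le_rfl),
    ENNReal.ofReal_add (by positivity) (by positivity), mul_add,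
    ENNReal.ofReal_add (by positivity) (by positivity)]
  -- for `x > s` the density times the conditional probability is at most a multiple of `e^{-x} / x`
  have key : ∀ x, s < x → ENNReal.ofReal (x ^ n / n.factorial * Real.exp (-x)) *
        gammaMeasure ((n + 1 : ℕ) : ℝ) 1 (Set.Iio (s / x))
      ≤ ENNReal.ofReal
        (s ^ (n + 1) / ((n + 1).factorial * n.factorial) * (x⁻¹ * Real.exp (-x))) := by
    intro x hx
    have hx0 : 0 < x := hs.trans hx
    refine (mul_le_mul_right (gammaMeasure_Iio_le n (by positivity)) _).trans ?_
    rw [← ENNReal.ofReal_mul (by positivity)]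
    refine ENNReal.ofReal_le_ofReal (le_of_eq ?_)
    rw [div_pow]
    field_simp
    ring
  refine add_le_add ?_ (add_le_add ?_ ?_)
  · rw [setLIntegral_congr Ioo_ae_eq_Ioc.symm, ← one_mul (s ^ (n + 1) / ((n + 1).factorial : ℝ)),
      ← setLIntegral_Ioo_pow_div_factorial n hs.le zero_le_one]
    refine setLIntegral_mono' measurableSet_Ioo fun x hx => ?_
    refine (mul_le_of_le_one_right' prob_le_one).trans (ENNReal.ofReal_le_ofReal ?_)
    have := hx.1
    rw [one_mul]
    exact mul_le_of_le_one_right (by positivity) (Real.exp_le_one_iff.2 (by linarith))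
  · rw [← one_div s, ← setLIntegral_Ioc_const_mul_inv hs hs1 hC]
    refine setLIntegral_mono' measurableSet_Ioc fun x hx => (key x hx.1).trans
      (ENNReal.ofReal_le_ofReal ?_)
    have := hs.trans hx.1
    gcongr
    exact mul_le_of_le_one_right (by positivity) (Real.exp_le_one_iff.2 (by linarith))
  · calc _ ≤ ∫⁻ x in Set.Ioi 1, ENNReal.ofReal
            (s ^ (n + 1) / ((n + 1).factorial * n.factorial) * Real.exp (-x)) := by
          refine setLIntegral_mono' measurableSet_Ioi fun x (hx : 1 < x) =>
            (key x (hs1.trans_lt hx)).trans (ENNReal.ofReal_le_ofReal ?_)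
          gcongr
          exact mul_le_of_le_one_left (Real.exp_nonneg _) (inv_le_one_of_one_le₀ hx.le)
      _ = ENNReal.ofReal (s ^ (n + 1) / ((n + 1).factorial * n.factorial) * Real.exp (-1)) := by
          rw [← ofReal_integral_eq_lintegral_ofReal, integral_const_mul, integral_exp_neg_Ioi]
          · exact (integrableOn_exp_neg_Ioi 1).const_mul _
          · exact ae_of_all _ fun x => by positivity
      _ ≤ _ := by
          refine ENNReal.ofReal_le_ofReal (mul_le_mul_of_nonneg_left ?_ hC)
          exact Real.exp_le_one_iff.2 (by norm_num)

lemma le_gammaProdCDF (n : ℕ) {s a b : ℝ} (hs : 0 < s) (ha : 0 < a) (hab : a ≤ b) :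
    s ^ (n + 1) / ((n + 1).factorial * n.factorial) * Real.exp (-b - s / a) * Real.log (b / a)
      ≤ gammaProdCDF n s := by
  have hQ : 0 ≤ gammaProdCDF n s := measureReal_nonneg
  rw [← ENNReal.ofReal_le_ofReal_iff hQ, ofReal_gammaProdCDF,
    ← setLIntegral_Ioc_const_mul_inv ha hab (by positivity)]
  refine (setLIntegral_mono' measurableSet_Ioc fun x hx => ?_).trans
    (lintegral_mono_set fun x hx => ha.trans hx.1)
  have hx0 : 0 < x := ha.trans hx.1
  refine le_trans ?_ (mul_le_mul_right (le_gammaMeasure_Iio n (by positivity)) _)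
  rw [← ENNReal.ofReal_mul (by positivity)]
  refine ENNReal.ofReal_le_ofReal ?_
  have hexp : Real.exp (-b - s / a) ≤ Real.exp (-x) * Real.exp (-(s / x)) := by
    rw [← Real.exp_add]
    have h1 : s / x ≤ s / a := div_le_div_of_nonneg_left hs.le ha hx.1.le
    have h2 := hx.2
    gcongr
    linarith
  calc _ ≤ s ^ (n + 1) / ((n + 1).factorial * n.factorial) *
        (Real.exp (-x) * Real.exp (-(s / x))) * x⁻¹ := by gcongr
    _ = _ := by
      rw [div_pow]
      field_simp
      ring

/-- Near zero the distribution function of the product of two independent Gamma variables of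
shape `n + 1` is asymptotic to `s ^ (n + 1) * log (1 / s)`, up to a constant: the logarithm comes
from `∫ dx / x` over the range of sizes of the first factor between `s` and `1`. -/
theorem tendsto_gammaProdCDF_div (n : ℕ) :
    Tendsto (fun s => gammaProdCDF n s / (s ^ (n + 1) * Real.log s⁻¹)) (𝓝[>] 0)
      (𝓝 (1 / ((n + 1).factorial * n.factorial))) := by
  set C : ℝ := 1 / ((n + 1).factorial * n.factorial) with hC
  have hCpos : 0 < C := by positivity
  have hlog : Tendsto (fun s : ℝ => Real.log s⁻¹) (𝓝[>] 0) atTop :=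
    Real.tendsto_log_atTop.comp tendsto_inv_nhdsGT_zero
  have hev : ∀ᶠ s : ℝ in 𝓝[>] 0, 0 < s ∧ s ≤ 1 ∧ 0 < Real.log s⁻¹ := by
    filter_upwards [Ioc_mem_nhdsGT one_pos, hlog.eventually_gt_atTop 0] with s h1 h2
    exact ⟨h1.1, h1.2, h2⟩
  refine tendsto_order.2 ⟨fun c hc => ?_, fun c hc => ?_⟩
  · -- the window `(s / δ, δ)` carries almost all of the mass, when `δ` is small
    have hδ : Tendsto (fun δ : ℝ => C * Real.exp (-δ - δ)) (𝓝[>] 0) (𝓝 C) := by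
      have : Continuous (fun δ : ℝ => C * Real.exp (-δ - δ)) := by fun_prop
      simpa using (this.tendsto 0).mono_left nhdsWithin_le_nhds
    obtain ⟨δ, hδc, hδ0⟩ := ((hδ.eventually_const_lt hc).and self_mem_nhdsWithin).exists
    replace hδ0 : 0 < δ := hδ0
    have hlim : Tendsto (fun s : ℝ => C * Real.exp (-δ - δ) *
        (1 + Real.log (δ * δ) * (Real.log s⁻¹)⁻¹)) (𝓝[>] 0) (𝓝 (C * Real.exp (-δ - δ))) := by
      simpa using (((tendsto_inv_atTop_zero.comp hlog).const_mul (Real.log (δ * δ))).const_add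
        1).const_mul (C * Real.exp (-δ - δ))
    filter_upwards [hev, hlim.eventually_const_lt hδc, Ioc_mem_nhdsGT (mul_pos hδ0 hδ0)]
      with s ⟨h0, h1, hl⟩ hlt hsδ
    refine hlt.trans_le ?_
    rw [le_div_iff₀ (by positivity)]
    refine le_trans (le_of_eq ?_) (le_gammaProdCDF n h0 (div_pos h0 hδ0)
      ((div_le_iff₀ hδ0).2 hsδ.2))
    have e1 : s / (s / δ) = δ := by field_simp
    have e2 : δ / (s / δ) = δ * δ * s⁻¹ := by field_simp
    rw [e1, e2, Real.log_mul (mul_pos hδ0 hδ0).ne' (inv_pos.2 h0).ne', hC]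
    generalize Real.log s⁻¹ = l at hl
    field_simp
    ring
  · have hlim : Tendsto (fun s : ℝ => C +
        ((1 / (n + 1).factorial : ℝ) + C) * (Real.log s⁻¹)⁻¹) (𝓝[>] 0) (𝓝 C) := by
      simpa using ((tendsto_inv_atTop_zero.comp hlog).const_mul
        ((1 / (n + 1).factorial : ℝ) + C)).const_add C
    filter_upwards [hev, hlim.eventually_lt_const hc] with s ⟨h0, h1, hl⟩ hlt
    refine lt_of_le_of_lt ?_ hlt
    rw [div_le_iff₀ (by positivity)]
    refine (gammaProdCDF_le n h0 h1).trans (le_of_eq ?_)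
    rw [hC]
    generalize Real.log s⁻¹ = l at hl
    field_simp
    ring

/-! ### The end-to-end signal-to-noise ratio -/

lemma star_dotProduct_self_eq_norm_sq {N : ℕ} (h : EuclideanSpace ℂ (Fin N)) :
    (fun j => star (h j)) ⬝ᵥ (fun j => h j) = ((‖h‖ ^ 2 : ℝ) : ℂ) := by
  rw [EuclideanSpace.norm_sq_eq, dotProduct]
  push_cast
  exact Finset.sum_congr rfl fun i _ => by rw [Complex.star_def, Complex.conj_mul']

namespace RelaySystem

variable {S : RelaySystem} {N : ℕ}

lemma norm_dotProduct_relayMatrix_mulVec (Ps : ℝ) (h₁ h₂ : EuclideanSpace ℂ (Fin N)) :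
    ‖(fun i => h₂ i) ⬝ᵥ (S.relayMatrix Ps h₁ h₂).mulVec (fun i => h₁ i)‖ ^ 2
      = S.powerFactor Ps h₁ ^ 2 * (‖h₁‖ ^ 2 * ‖h₂‖ ^ 2) := by
  rw [relayMatrix, Matrix.smul_mulVec, Matrix.vecMulVec_mulVec, star_dotProduct_self_eq_norm_sq,
    dotProduct_smul, dotProduct_smul, dotProduct_comm, star_dotProduct_self_eq_norm_sq]
  simp only [smul_eq_mul, MulOpposite.smul_eq_mul_unop, MulOpposite.unop_op, norm_mul,
    Complex.norm_real, mul_pow, Real.norm_eq_abs, sq_abs]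
  rcases eq_or_ne ‖h₁‖ 0 with h | h
  · simp [h]
  rcases eq_or_ne ‖h₂‖ 0 with h' | h'
  · simp [h']
  field_simp

lemma sum_norm_vecMul_relayMatrix (Ps : ℝ) (h₁ h₂ : EuclideanSpace ℂ (Fin N)) :
    ∑ j, ‖Matrix.vecMul (fun i => h₂ i) (S.relayMatrix Ps h₁ h₂) j‖ ^ 2
      = S.powerFactor Ps h₁ ^ 2 * ‖h₂‖ ^ 2 := by
  rw [relayMatrix, Matrix.vecMul_smul, Matrix.vecMul_vecMulVec, dotProduct_comm,
    star_dotProduct_self_eq_norm_sq]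
  simp only [Pi.smul_apply, smul_eq_mul, norm_mul, norm_star, Complex.norm_real, mul_pow,
    Real.norm_eq_abs, sq_abs]
  rw [← Finset.mul_sum, ← Finset.mul_sum, ← EuclideanSpace.norm_sq_eq]
  rcases eq_or_ne ‖h₁‖ 0 with h | h
  · -- without a first hop the relay harvests nothing and stays silent
    simp [h, powerFactor, relayPower, harvestedEnergy]
  rcases eq_or_ne ‖h₂‖ 0 with h' | h'
  · simp [h']
  field_simp

/-- The end-to-end signal-to-noise ratio is `u v / (u + v + 1)`, where `u` and `v` are the
signal-to-noise ratios of the two hops. -/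
lemma snr_eq (hθ₀ : 0 < S.θ) (hθ₁ : S.θ < 1) (hη : 0 < S.η) (hd₁ : 0 < S.d₁) (hd₂ : 0 < S.d₂)
    (hT : 0 < S.T) (hN₀ : 0 < S.N₀) {ρ : ℝ} (hρ : 0 < ρ) (h₁ h₂ : EuclideanSpace ℂ (Fin N)) :
    S.snr (ρ * S.N₀) h₁ h₂ =
      ((1 - S.θ) * ρ / S.d₁ ^ S.τ * ‖h₁‖ ^ 2) *
          (S.η * S.θ * ρ / (S.d₁ ^ S.τ * S.d₂ ^ S.τ) * (‖h₁‖ ^ 2 * ‖h₂‖ ^ 2)) /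
        (S.η * S.θ * ρ / (S.d₁ ^ S.τ * S.d₂ ^ S.τ) * (‖h₁‖ ^ 2 * ‖h₂‖ ^ 2) +
          (1 - S.θ) * ρ / S.d₁ ^ S.τ * ‖h₁‖ ^ 2 + 1) := by
  have hD₁ : 0 < S.d₁ ^ S.τ := Real.rpow_pos_of_pos hd₁ _
  have hD₂ : 0 < S.d₂ ^ S.τ := Real.rpow_pos_of_pos hd₂ _
  have hθ : 0 < 1 - S.θ := sub_pos.2 hθ₁
  have hω : S.powerFactor (ρ * S.N₀) h₁ ^ 2 = S.η * S.θ * ρ / S.d₁ ^ S.τ * ‖h₁‖ ^ 2 /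
      ((1 - S.θ) * ρ / S.d₁ ^ S.τ * ‖h₁‖ ^ 2 + 1) := by
    rw [powerFactor, relayPower, harvestedEnergy, Real.sq_sqrt (by positivity)]
    field_simp
  rw [snr, signalPower, noisePower, norm_dotProduct_relayMatrix_mulVec,
    sum_norm_vecMul_relayMatrix, hω]
  have hX := sq_nonneg ‖h₁‖
  have hY := sq_nonneg ‖h₂‖
  generalize ‖h₁‖ ^ 2 = X at hX ⊢
  generalize ‖h₂‖ ^ 2 = Y at hY ⊢
  generalize S.d₁ ^ S.τ = D₁ at hD₁ ⊢
  generalize S.d₂ ^ S.τ = D₂ at hD₂ ⊢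
  generalize 1 - S.θ = κ at hθ ⊢
  have hu : 0 < κ * ρ / D₁ * X + 1 := by positivity
  rw [div_eq_div_iff (by positivity) (by positivity)]
  field_simp
  ring

end RelaySystem

/-- The two-hop link is in outage whenever its second hop is. -/
lemma two_hop_snr_lt {u v g : ℝ} (hu : 0 ≤ u) (hv : 0 ≤ v) (hvg : v < g) :
    u * v / (v + u + 1) < g := by
  rw [div_lt_iff₀ (by positivity)]
  nlinarith [mul_nonneg hu (sub_nonneg.2 hvg.le), mul_nonneg (hv.trans hvg.le) hv]

/-- If the first hop has a large signal-to-noise ratio `u ≥ M`, then outage forces the second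
hop below a threshold close to `g`. -/
lemma lt_of_two_hop_snr_lt {u v g M : ℝ} (hv : 0 ≤ v) (hg : 0 < g) (hM : g < M) (hu : M ≤ u)
    (h : u * v / (v + u + 1) < g) : v < g * ((M + 1) / (M - g)) := by
  have hMg : 0 < M - g := sub_pos.2 hM
  have hu0 : 0 < u := hg.trans (hM.trans_le hu)
  have hug : 0 < u - g := by linarith
  rw [div_lt_iff₀ (by positivity)] at h
  have h1 : v < g * ((u + 1) / (u - g)) := by
    rw [← mul_div_assoc, lt_div_iff₀ hug]
    linarith
  refine h1.trans_le (mul_le_mul_of_nonneg_left ?_ hg.le)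
  rw [div_le_div_iff₀ hug hMg]
  nlinarith [mul_nonneg (sub_nonneg.2 hu) hg.le]

/-! ### Bounds for the outage probability -/

section Outage

variable {Ω : Type*} [MeasurableSpace Ω] {P : Measure Ω} [IsProbabilityMeasure P] {n : ℕ}
  {h₁ h₂ : Ω → EuclideanSpace ℂ (Fin (n + 1))}

lemma IsRayleighChannelPair.measureReal_mul_lt (hch : IsRayleighChannelPair P h₁ h₂) (s : ℝ) :
    P.real {w | ‖h₁ w‖ ^ 2 * ‖h₂ w‖ ^ 2 < s} = gammaProdCDF n s :=
  hch.hasLaw_norm_sq.measureReal_eq (p := fun z => z.1 * z.2 < s) (measurableSet_mul_lt s)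

lemma IsRayleighChannelPair.measureReal_norm_sq_lt_le (hch : IsRayleighChannelPair P h₁ h₂)
    {t : ℝ} (ht : 0 ≤ t) :
    P.real {w | ‖h₁ w‖ ^ 2 < t} ≤ t ^ (n + 1) / (n + 1).factorial := by
  have hset : {z : ℝ × ℝ | z.1 < t} = Set.Iio t ×ˢ Set.univ := by ext; simp
  rw [hch.hasLaw_norm_sq.measureReal_eq (p := fun z => z.1 < t)
    (measurableSet_lt measurable_fst measurable_const), hset, measureReal_def,
    Measure.prod_prod, measure_univ, mul_one]
  exact ENNReal.toReal_le_of_le_ofReal (by positivity) (gammaMeasure_Iio_le n ht)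

variable {S : RelaySystem}

lemma gammaProdCDF_le_outageProb (hch : IsRayleighChannelPair P h₁ h₂) (hθ₀ : 0 < S.θ)
    (hθ₁ : S.θ < 1) (hη : 0 < S.η) (hd₁ : 0 < S.d₁) (hd₂ : 0 < S.d₂) (hT : 0 < S.T)
    (hN₀ : 0 < S.N₀) (g : ℝ) {ρ : ℝ} (hρ : 0 < ρ) :
    gammaProdCDF n (S.d₁ ^ S.τ * g * (S.d₂ ^ S.τ / (S.η * S.θ)) / ρ)
      ≤ S.outageProb P h₁ h₂ g ρ := by
  have hD₁ : 0 < S.d₁ ^ S.τ := Real.rpow_pos_of_pos hd₁ _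
  have hD₂ : 0 < S.d₂ ^ S.τ := Real.rpow_pos_of_pos hd₂ _
  have hθ : 0 < 1 - S.θ := sub_pos.2 hθ₁
  rw [← hch.measureReal_mul_lt, RelaySystem.outageProb]
  refine measureReal_mono fun w hw => ?_
  rw [Set.mem_ofPred_eq, lt_div_iff₀ hρ] at hw
  rw [Set.mem_ofPred_eq, RelaySystem.snr_eq hθ₀ hθ₁ hη hd₁ hd₂ hT hN₀ hρ]
  refine two_hop_snr_lt (by positivity) (by positivity) ?_
  calc _ = S.η * S.θ / (S.d₁ ^ S.τ * S.d₂ ^ S.τ) * (‖h₁ w‖ ^ 2 * ‖h₂ w‖ ^ 2 * ρ) := by ring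
    _ < S.η * S.θ / (S.d₁ ^ S.τ * S.d₂ ^ S.τ) *
        (S.d₁ ^ S.τ * g * (S.d₂ ^ S.τ / (S.η * S.θ))) := by gcongr
    _ = g := by field_simp

lemma outageProb_le (hch : IsRayleighChannelPair P h₁ h₂) (hθ₀ : 0 < S.θ)
    (hθ₁ : S.θ < 1) (hη : 0 < S.η) (hd₁ : 0 < S.d₁) (hd₂ : 0 < S.d₂) (hT : 0 < S.T)
    (hN₀ : 0 < S.N₀) {g M : ℝ} (hg : 0 < g) (hM : g < M) {ρ : ℝ} (hρ : 0 < ρ) :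
    S.outageProb P h₁ h₂ g ρ ≤
      (M * S.d₁ ^ S.τ / (1 - S.θ) / ρ) ^ (n + 1) / (n + 1).factorial +
      gammaProdCDF n
        (S.d₁ ^ S.τ * g * (S.d₂ ^ S.τ / (S.η * S.θ)) * ((M + 1) / (M - g)) / ρ) := by
  have hD₁ : 0 < S.d₁ ^ S.τ := Real.rpow_pos_of_pos hd₁ _
  have hD₂ : 0 < S.d₂ ^ S.τ := Real.rpow_pos_of_pos hd₂ _
  have hθ : 0 < 1 - S.θ := sub_pos.2 hθ₁
  have hM0 : 0 < M := hg.trans hM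
  refine le_trans ?_ (add_le_add_left (hch.measureReal_norm_sq_lt_le (by positivity)) _)
  rw [← hch.measureReal_mul_lt, RelaySystem.outageProb]
  refine le_trans (measureReal_mono fun w hw => ?_) (measureReal_union_le _ _)
  rw [Set.mem_ofPred_eq, RelaySystem.snr_eq hθ₀ hθ₁ hη hd₁ hd₂ hT hN₀ hρ] at hw
  rcases lt_or_ge (‖h₁ w‖ ^ 2) (M * S.d₁ ^ S.τ / (1 - S.θ) / ρ) with hlt | hge
  · exact Or.inl hlt
  · right
    have hu : M ≤ (1 - S.θ) * ρ / S.d₁ ^ S.τ * ‖h₁ w‖ ^ 2 := by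
      calc M = (1 - S.θ) * ρ / S.d₁ ^ S.τ * (M * S.d₁ ^ S.τ / (1 - S.θ) / ρ) := by field_simp
        _ ≤ _ := by gcongr
    have hv := lt_of_two_hop_snr_lt (by positivity) hg hM hu hw
    rw [Set.mem_ofPred_eq, lt_div_iff₀ hρ]
    calc _ = S.d₁ ^ S.τ * (S.d₂ ^ S.τ / (S.η * S.θ)) *
          (S.η * S.θ * ρ / (S.d₁ ^ S.τ * S.d₂ ^ S.τ) * (‖h₁ w‖ ^ 2 * ‖h₂ w‖ ^ 2)) := by
          field_simp
      _ < S.d₁ ^ S.τ * (S.d₂ ^ S.τ / (S.η * S.θ)) * (g * ((M + 1) / (M - g))) := by gcongr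
      _ = _ := by ring

/-! ### Asymptotics at high signal-to-noise ratio -/

lemma tendsto_gammaProdCDF_const_div (n : ℕ) {c : ℝ} (hc : 0 < c) :
    Tendsto (fun ρ => gammaProdCDF n (c / ρ) / (Real.log ρ / ρ ^ (n + 1))) atTop
      (𝓝 (c ^ (n + 1) / ((n + 1).factorial * n.factorial))) := by
  have hs : Tendsto (fun ρ : ℝ => c / ρ) atTop (𝓝[>] 0) :=
    tendsto_nhdsWithin_iff.2 ⟨tendsto_id.const_div_atTop c,
      (eventually_gt_atTop 0).mono fun ρ hρ => div_pos hc hρ⟩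
  have h1 := (tendsto_gammaProdCDF_div n).comp hs
  have h2 : Tendsto (fun ρ : ℝ => c ^ (n + 1) * (1 - Real.log c * (Real.log ρ)⁻¹)) atTop
      (𝓝 (c ^ (n + 1))) := by
    simpa using (((tendsto_inv_atTop_zero.comp Real.tendsto_log_atTop).const_mul
      (Real.log c)).const_sub 1).const_mul (c ^ (n + 1))
  have h3 := h1.mul h2
  rw [one_div_mul_eq_div] at h3
  refine h3.congr' ?_
  filter_upwards [eventually_gt_atTop 1, eventually_gt_atTop c] with ρ h1ρ hcρ
  have hρ : 0 < ρ := one_pos.trans h1ρ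
  have hl : 0 < Real.log ρ := Real.log_pos h1ρ
  have hl' : 0 < Real.log ρ - Real.log c := sub_pos.2 (Real.log_lt_log hc hcρ)
  simp only [Function.comp_apply]
  rw [inv_div, Real.log_div hρ.ne' hc.ne', div_pow]
  generalize Real.log ρ = l at *
  generalize Real.log c = k at *
  generalize gammaProdCDF n (c / ρ) = Q
  field_simp

/-- The outage probability divided by `log ρ / ρ ^ (n + 1)` converges. -/
theorem tendsto_outageProb_div (hch : IsRayleighChannelPair P h₁ h₂) (hθ₀ : 0 < S.θ)
    (hθ₁ : S.θ < 1) (hη : 0 < S.η) (hd₁ : 0 < S.d₁) (hd₂ : 0 < S.d₂) (hT : 0 < S.T)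
    (hN₀ : 0 < S.N₀) {g : ℝ} (hg : 0 < g) :
    Tendsto (fun ρ => S.outageProb P h₁ h₂ g ρ / (Real.log ρ / ρ ^ (n + 1))) atTop
      (𝓝 ((S.d₁ ^ S.τ * g * (S.d₂ ^ S.τ / (S.η * S.θ))) ^ (n + 1) /
        ((n + 1).factorial * n.factorial))) := by
  have hD₁ : 0 < S.d₁ ^ S.τ := Real.rpow_pos_of_pos hd₁ _
  have hD₂ : 0 < S.d₂ ^ S.τ := Real.rpow_pos_of_pos hd₂ _
  have hθ : 0 < 1 - S.θ := sub_pos.2 hθ₁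
  set A : ℝ := S.d₁ ^ S.τ * g * (S.d₂ ^ S.τ / (S.η * S.θ)) with hA
  have hA0 : 0 < A := by positivity
  refine tendsto_order.2 ⟨fun c hc => ?_, fun c hc => ?_⟩
  · filter_upwards [(tendsto_gammaProdCDF_const_div n hA0).eventually_const_lt hc,
      eventually_gt_atTop 1] with ρ h hρ
    have hρ0 : 0 < ρ := one_pos.trans hρ
    have hl : 0 < Real.log ρ := Real.log_pos hρ
    refine h.trans_le ?_
    gcongr
    exact gammaProdCDF_le_outageProb hch hθ₀ hθ₁ hη hd₁ hd₂ hT hN₀ g hρ0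
  · have hratio : Tendsto (fun M : ℝ => (M + 1) / (M - g)) atTop (𝓝 1) := by
      have h1 : Tendsto (fun M : ℝ => 1 + (1 + g) * (M - g)⁻¹) atTop (𝓝 1) := by
        simpa [sub_eq_add_neg] using ((tendsto_inv_atTop_zero.comp
          (tendsto_atTop_add_const_right atTop (-g) tendsto_id)).const_mul (1 + g)).const_add 1
      refine h1.congr' ?_
      filter_upwards [eventually_gt_atTop g] with M hM
      have : M - g ≠ 0 := (sub_pos.2 hM).ne'
      field_simp
      ring
    have hconst : Tendsto (fun M : ℝ => (A * ((M + 1) / (M - g))) ^ (n + 1) /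
        ((n + 1).factorial * n.factorial : ℝ)) atTop
        (𝓝 (A ^ (n + 1) / ((n + 1).factorial * n.factorial))) := by
      simpa using ((hratio.const_mul A).pow (n + 1)).div_const
        ((n + 1).factorial * n.factorial : ℝ)
    obtain ⟨M, hMc, hM⟩ := ((hconst.eventually_lt_const hc).and (eventually_gt_atTop g)).exists
    have hMg : 0 < M - g := sub_pos.2 hM
    have hM0 : 0 < M := hg.trans hM
    -- the event that the first hop is in a deep fade has no logarithm and is negligible
    have hfade : Tendsto (fun ρ : ℝ =>
        (M * S.d₁ ^ S.τ / (1 - S.θ)) ^ (n + 1) / (n + 1).factorial * (Real.log ρ)⁻¹) atTop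
        (𝓝 0) := by
      simpa using (tendsto_inv_atTop_zero.comp Real.tendsto_log_atTop).const_mul
        ((M * S.d₁ ^ S.τ / (1 - S.θ)) ^ (n + 1) / ((n + 1).factorial : ℝ))
    have hsum := hfade.add (tendsto_gammaProdCDF_const_div n
      (c := A * ((M + 1) / (M - g))) (by positivity))
    rw [zero_add] at hsum
    filter_upwards [hsum.eventually_lt_const hMc, eventually_gt_atTop 1] with ρ h hρ
    have hρ0 : 0 < ρ := one_pos.trans hρ
    have hl : 0 < Real.log ρ := Real.log_pos hρ
    refine lt_of_le_of_lt ?_ h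
    refine (div_le_div_of_nonneg_right
      (outageProb_le hch hθ₀ hθ₁ hη hd₁ hd₂ hT hN₀ hg hM hρ0) (by positivity)).trans
      (le_of_eq ?_)
    rw [add_div, div_pow _ ρ]
    congr 1
    field_simp

end Outage

/-- Decay of order `ρ ^ (-N) * log ρ` gives diversity order `N`. -/
lemma hasDiversityOrder_of_tendsto_div {p : ℝ → ℝ} {N : ℕ} {L : ℝ} (hL : 0 < L)
    (hp : Tendsto (fun ρ => p ρ / (Real.log ρ / ρ ^ N)) atTop (𝓝 L)) :
    HasDiversityOrder p N := by
  have hlog := Real.tendsto_log_atTop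
  have h1 : Tendsto (fun ρ => Real.log (p ρ / (Real.log ρ / ρ ^ N)) * (Real.log ρ)⁻¹) atTop
      (𝓝 0) := by
    simpa using (hp.log hL.ne').mul (tendsto_inv_atTop_zero.comp hlog)
  have h2 : Tendsto (fun ρ : ℝ => Real.log (Real.log ρ) / Real.log ρ) atTop (𝓝 0) :=
    (Real.isLittleO_log_id_atTop.tendsto_div_nhds_zero).comp hlog
  have h3 : Tendsto (fun ρ : ℝ => (N : ℝ) - Real.log (Real.log ρ) / Real.log ρ -
      Real.log (p ρ / (Real.log ρ / ρ ^ N)) * (Real.log ρ)⁻¹) atTop (𝓝 N) := by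
    simpa using (h2.const_sub (N : ℝ)).sub h1
  refine h3.congr' ?_
  filter_upwards [eventually_gt_atTop 1, hp.eventually_const_lt hL] with ρ hρ hpos
  have hρ0 : 0 < ρ := one_pos.trans hρ
  have hl : 0 < Real.log ρ := Real.log_pos hρ
  have hw : 0 < Real.log ρ / ρ ^ N := by positivity
  have hp0 : 0 < p ρ := by
    have := mul_pos hpos hw
    rwa [div_mul_cancel₀ _ hw.ne'] at this
  rw [Real.log_div hp0.ne' hw.ne', Real.log_div hl.ne' (by positivity), Real.log_pow]
  field_simp
  ring

/-- A function of the form `K ρ⁻ᴺ (α + β log ρ)`, divided by `log ρ / ρ ^ N`, tends to `K β`. -/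
lemma tendsto_affine_log_div (N : ℕ) (K α β : ℝ) :
    Tendsto (fun ρ : ℝ => K / ρ ^ N * (α + β * Real.log ρ) / (Real.log ρ / ρ ^ N)) atTop
      (𝓝 (K * β)) := by
  have h : Tendsto (fun ρ : ℝ => K * (α * (Real.log ρ)⁻¹ + β)) atTop (𝓝 (K * β)) := by
    simpa using (((tendsto_inv_atTop_zero.comp Real.tendsto_log_atTop).const_mul
      α).add_const β).const_mul K
  refine h.congr' ?_
  filter_upwards [eventually_gt_atTop 1] with ρ hρ
  have hρ0 : 0 < ρ := one_pos.trans hρ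
  have hl : 0 < Real.log ρ := Real.log_pos hρ
  field_simp

lemma isEquivalent_of_tendsto_div {f g w : ℝ → ℝ} {L : ℝ} (hL : L ≠ 0)
    (hf : Tendsto (fun x => f x / w x) atTop (𝓝 L))
    (hg : Tendsto (fun x => g x / w x) atTop (𝓝 L)) (hw : ∀ᶠ x in atTop, w x ≠ 0) :
    f ~[atTop] g := by
  have hg0 : ∀ᶠ x in atTop, g x ≠ 0 := by
    filter_upwards [hg.eventually_ne hL] with x hx h0
    simp [h0] at hx
  rw [isEquivalent_iff_tendsto_one hg0]
  have := hf.div hg hL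
  rw [div_self hL] at this
  refine this.congr' ?_
  filter_upwards [hw] with x hx
  exact div_div_div_cancel_right₀ hx _ _

theorem theorem2 {Ω : Type*} [MeasurableSpace Ω] (P : Measure Ω) [IsProbabilityMeasure P]
    {N : ℕ} (hN : 1 ≤ N) (h₁ h₂ : Ω → EuclideanSpace ℂ (Fin N))
    (hch : IsRayleighChannelPair P h₁ h₂)
    (S : RelaySystem) (hθ₀ : 0 < S.θ) (hθ₁ : S.θ < 1) (hη : 0 < S.η)
    (hd₁ : 0 < S.d₁) (hd₂ : 0 < S.d₂) (hT : 0 < S.T) (hN₀ : 0 < S.N₀)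
    (γth : ℝ) (hγ : 0 < γth) :
    -- high-SNR approximation of the outage probability
    (fun ρ₁ : ℝ => S.outageProb P h₁ h₂ γth ρ₁) ~[atTop]
      (fun ρ₁ : ℝ =>
        (S.d₁ ^ S.τ * γth / ρ₁) ^ N / Real.Gamma (N + 1) *
          (1 / (1 - S.θ) ^ N +
            (Real.log ((1 - S.θ) * ρ₁) - Real.log (S.d₁ ^ S.τ * γth)
                - Real.eulerMascheroniConstant) / Real.Gamma N *
              (S.d₂ ^ S.τ / (S.η * S.θ)) ^ N)) ∧
    -- the diversity order is `N`
    HasDiversityOrder (fun ρ₁ : ℝ => S.outageProb P h₁ h₂ γth ρ₁) N ∧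
    -- the decay is that of `ρ₁ ^ (-N) * ln ρ₁`
    (fun ρ₁ : ℝ => S.outageProb P h₁ h₂ γth ρ₁) ~[atTop]
      (fun ρ₁ : ℝ =>
        (S.d₁ ^ S.τ * γth * (S.d₂ ^ S.τ / (S.η * S.θ))) ^ N /
            (Real.Gamma (N + 1) * Real.Gamma N) *
          (Real.log ρ₁ / ρ₁ ^ N)) := by
  obtain ⟨n, rfl⟩ : ∃ n, N = n + 1 := ⟨N - 1, by omega⟩
  have hlim := tendsto_outageProb_div hch hθ₀ hθ₁ hη hd₁ hd₂ hT hN₀ hγ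
  have hD₁ : 0 < S.d₁ ^ S.τ := Real.rpow_pos_of_pos hd₁ _
  have hD₂ : 0 < S.d₂ ^ S.τ := Real.rpow_pos_of_pos hd₂ _
  have hθ : 0 < 1 - S.θ := sub_pos.2 hθ₁
  have hw : ∀ᶠ ρ : ℝ in atTop, Real.log ρ / ρ ^ (n + 1) ≠ 0 := by
    filter_upwards [eventually_gt_atTop 1] with ρ hρ
    exact div_ne_zero (Real.log_pos hρ).ne' (by positivity)
  have hΓ : Real.Gamma ((n + 1 : ℕ) : ℝ) = n.factorial := by
    rw [Nat.cast_add_one, Real.Gamma_nat_eq_factorial]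
  rw [Real.Gamma_nat_eq_factorial, hΓ]
  have hL : 0 < (S.d₁ ^ S.τ * γth * (S.d₂ ^ S.τ / (S.η * S.θ))) ^ (n + 1) /
        ((n + 1).factorial * n.factorial : ℝ) := by positivity
  refine ⟨isEquivalent_of_tendsto_div hL.ne' hlim ?_ hw,
    hasDiversityOrder_of_tendsto_div hL hlim,
    isEquivalent_of_tendsto_div hL.ne' hlim ?_ hw⟩
  · have h := tendsto_affine_log_div (n + 1) ((S.d₁ ^ S.τ * γth) ^ (n + 1) / (n + 1).factorial)
      (1 / (1 - S.θ) ^ (n + 1) + (Real.log (1 - S.θ) - Real.log (S.d₁ ^ S.τ * γth)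
        - Real.eulerMascheroniConstant) / n.factorial * (S.d₂ ^ S.τ / (S.η * S.θ)) ^ (n + 1))
      ((S.d₂ ^ S.τ / (S.η * S.θ)) ^ (n + 1) / n.factorial)
    have hc : (S.d₁ ^ S.τ * γth) ^ (n + 1) / ((n + 1).factorial : ℝ) *
        ((S.d₂ ^ S.τ / (S.η * S.θ)) ^ (n + 1) / n.factorial) =
        (S.d₁ ^ S.τ * γth * (S.d₂ ^ S.τ / (S.η * S.θ))) ^ (n + 1) /
        ((n + 1).factorial * n.factorial : ℝ) := by
      rw [mul_pow _ (S.d₂ ^ S.τ / (S.η * S.θ)), div_mul_div_comm]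
    rw [hc] at h
    refine h.congr' ?_
    filter_upwards [eventually_gt_atTop 0] with ρ hρ
    rw [Real.log_mul hθ.ne' hρ.ne', div_pow _ ρ]
    congr 1
    ring
  · refine tendsto_const_nhds.congr' ?_
    filter_upwards [hw] with ρ hρ
    rw [mul_div_cancel_right₀ _ hρ]
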